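/- Let $n\in\mathbb N$ and let $\Omega\subset\mathbb{C}^n$ be a bounded Reinhardt domain, i.e. a bounded, nonempty, connected open set such that $(e^{i\theta_1}z_1,\dots,e^{i\theta_n}z_n)\in\Omega$ whenever $(z_1,\dots,z_n)\in\Omega$ and $\theta_1,\dots,\theta_n\in\mathbb{R}$. For a function $\varphi:\Omega\to\mathbb{R}$ let $$P(\varphi)(z):=\sup\{u(z) : u \text{ plurisubharmonic on } \Omega,\ u^*\le\varphi \text{ on } \Omega\},\qquad z\in\Omega,$$ denote its Perron--Bremermann envelope, where $u^*(z)=\limsup_{\Omega\ni\zeta\to z}u(\zeta)$ is the upper semicontinuous regularization of $u$ (with $\zeta=z$ allowed). If $\varphi$ is uniformly continuous on $\Omega$, then $P(\varphi)$ is a (finite) real-valued continuous function on $\Omega$. -/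

import Mathlib

open MeasureTheory Filter Topology

/-- A Reinhardt domain in `ℂⁿ`: a nonempty connected open set that is invariant under the action
of the torus `(S¹)ⁿ` by coordinatewise multiplication. (The topology and the uniformity of
`Fin n → ℂ` are those of `ℂⁿ` with its Euclidean norm, and so are its bounded sets.) -/
structure IsReinhardtDomain {n : ℕ} (Ω : Set (Fin n → ℂ)) : Prop where
  isOpen : IsOpen Ω
  isConnected : IsConnected Ω
  torus_mul_mem : ∀ z ∈ Ω, ∀ t : Fin n → ℂ, (∀ j, ‖t j‖ = 1) → (fun j => t j * z j) ∈ Ω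

/-- The Lebesgue integral `∫ f⁺ - ∫ f⁻` of an extended real valued function. It is used below
only where `∫ f⁺ < ∞`; it then has its usual value, which may be `-∞`. -/
noncomputable def extIntegral {α : Type*} [MeasurableSpace α] (μ : Measure α) (f : α → EReal) :
    EReal :=
  ((∫⁻ x, (f x).toENNReal ∂μ : ENNReal) : EReal) - ((∫⁻ x, (-f x).toENNReal ∂μ : ENNReal) : EReal)

/-- The mean value `(2π)⁻¹ ∫₀^{2π} u (a + e^{iθ} w) dθ`. -/
noncomputable def circleMean {n : ℕ} (u : (Fin n → ℂ) → EReal) (a w : Fin n → ℂ) : EReal :=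
  (((2 * Real.pi)⁻¹ : ℝ) : EReal) *
    extIntegral (volume.restrict (Set.Ioc (0 : ℝ) (2 * Real.pi)))
      (fun θ : ℝ => u (a + Complex.exp ((θ : ℂ) * Complex.I) • w))

/-- `u` is plurisubharmonic on the open set `Ω`: it takes values in `[-∞, ∞)`, is upper
semicontinuous, and satisfies the sub-mean value inequality on every closed disc that lies in a
complex line and is contained in `Ω`. The function `-∞` is allowed. Only the values of `u` on `Ω`
matter. -/
structure IsPSH {n : ℕ} (Ω : Set (Fin n → ℂ)) (u : (Fin n → ℂ) → EReal) : Prop where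
  lt_top : ∀ z ∈ Ω, u z < ⊤
  usc : UpperSemicontinuousOn u Ω
  le_circleMean : ∀ a w : Fin n → ℂ, (∀ ζ : ℂ, ‖ζ‖ ≤ 1 → a + ζ • w ∈ Ω) → u a ≤ circleMean u a w

/-- The upper semicontinuous regularization `u*` of a function `u` on `Ω`, that is
`u* z = limsup u ζ` as `ζ → z` in `Ω` (where `ζ = z` is allowed if `z ∈ Ω`). -/
noncomputable def uscReg {n : ℕ} (Ω : Set (Fin n → ℂ)) (u : (Fin n → ℂ) → EReal)
    (z : Fin n → ℂ) : EReal :=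
  limsup u (𝓝[Ω] z)

/-- The Perron–Bremermann envelope of `φ : Ω → ℝ`,
`P(φ)(z) = sup {u z | u plurisubharmonic on Ω, u* ≤ φ on Ω}`. -/
noncomputable def perronBremermann {n : ℕ} (Ω : Set (Fin n → ℂ)) (φ : (Fin n → ℂ) → ℝ)
    (z : Fin n → ℂ) : EReal :=
  sSup {x : EReal | ∃ u : (Fin n → ℂ) → EReal,
    IsPSH Ω u ∧ (∀ ζ ∈ Ω, uscReg Ω u ζ ≤ (φ ζ : EReal)) ∧ u z = x}

/-! The envelope lies between the constants `-M` and `M` bounding `φ`. Its upper regularization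
inherits the sub-mean value inequality from the competitors (Fatou) and stays below the continuous
`φ`, so it is itself a competitor. Hence the envelope is a plurisubharmonic real function `g`, and
only lower semicontinuity is left.

Since `Ω` is bounded and torus-invariant, a small rotation of one coordinate moves all points
little. By uniform continuity of `φ`, `g` composed with the rotation, minus `τ`, is then a
competitor: small rotations raise `g` by at most `τ`.

Now replace the coordinates of `a` by those of a nearby `z` one at a time; no step may lower `g`
much. If `a j = 0`, take the mean over the circle of radius `‖z j‖`: `g` is almost at most `g a`
everywhere, and on an arc of fixed angle around `z j` it is at most the new value plus an error, so
a low new value would pull the mean below the value at the centre. If `a j ≠ 0`, scale it to `1`. On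
the circle about `0` through the new point `ζ`, `g` is near 1 bounded by its value at `ζ` plus `τ`,
and the maximum principle with an explicit superharmonic barrier carries this bound to `1`. -/

/-! ### Circle means and the sub-mean value inequality. -/

theorem extIntegral_mono {α : Type*} [MeasurableSpace α] (μ : Measure α) {f g : α → EReal}
    (h : ∀ x, f x ≤ g x) : extIntegral μ f ≤ extIntegral μ g := by
  unfold extIntegral
  apply EReal.sub_le_sub
  · exact_mod_cast lintegral_mono fun x => EReal.toENNReal_le_toENNReal (h x)
  · exact_mod_cast lintegral_mono fun x =>
      EReal.toENNReal_le_toENNReal (EReal.neg_le_neg_iff.2 (h x))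

theorem extIntegral_coe {α : Type*} [MeasurableSpace α] {μ : Measure α} {k : α → ℝ}
    (hk : Integrable k μ) :
    extIntegral μ (fun x => (k x : EReal)) = ((∫ x, k x ∂μ : ℝ) : EReal) := by
  have h1 : ∫⁻ x, ENNReal.ofReal (k x) ∂μ ≠ ⊤ := hk.lintegral_lt_top.ne
  have h2 : ∫⁻ x, ENNReal.ofReal (-k x) ∂μ ≠ ⊤ := hk.neg.lintegral_lt_top.ne
  rw [integral_eq_lintegral_pos_part_sub_lintegral_neg_part hk]
  simp only [extIntegral, ← EReal.coe_neg, EReal.real_coe_toENNReal, EReal.coe_sub]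
  rw [← EReal.toReal_coe_ennreal, ← EReal.toReal_coe_ennreal, EReal.coe_toReal, EReal.coe_toReal] <;>
    simp [h1, h2]

/-- The mean of a real function over `(0, 2π]`. -/
noncomputable def angleMean (k : ℝ → ℝ) : ℝ :=
  (2 * Real.pi)⁻¹ * ∫ θ in Set.Ioc (0 : ℝ) (2 * Real.pi), k θ

theorem angleMean_le {k : ℝ → ℝ} {M : ℝ}
    (hk : IntegrableOn k (Set.Ioc (0 : ℝ) (2 * Real.pi))) (h : ∀ θ, k θ ≤ M) :
    angleMean k ≤ M := by
  have h1 : ∫ θ in Set.Ioc (0 : ℝ) (2 * Real.pi), k θ ≤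
      ∫ _ in Set.Ioc (0 : ℝ) (2 * Real.pi), M :=
    integral_mono hk (integrable_const M) h
  have hpi := Real.pi_pos
  rw [setIntegral_const, Real.volume_real_Ioc_of_le (by positivity)] at h1
  rw [angleMean, inv_mul_le_iff₀ (by positivity)]
  simpa using h1

/-- Monotonicity of the lower integral needs no measurability, so an `EReal`-valued competitor can
be tested against a real integrable majorant. -/
theorem IsPSH.le_angleMean {n : ℕ} {Ω : Set (Fin n → ℂ)} {u : (Fin n → ℂ) → EReal}
    (hu : IsPSH Ω u) {a w : Fin n → ℂ} (hd : ∀ ζ : ℂ, ‖ζ‖ ≤ 1 → a + ζ • w ∈ Ω) {k : ℝ → ℝ}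
    (hk : IntegrableOn k (Set.Ioc (0 : ℝ) (2 * Real.pi)))
    (h : ∀ θ : ℝ, u (a + Complex.exp ((θ : ℂ) * Complex.I) • w) ≤ (k θ : EReal)) :
    u a ≤ (angleMean k : EReal) := by
  refine (hu.le_circleMean a w hd).trans ?_
  rw [angleMean, EReal.coe_mul, ← extIntegral_coe hk, circleMean]
  exact mul_le_mul_of_nonneg_left (extIntegral_mono _ h)
    (by exact_mod_cast (by positivity : (0 : ℝ) ≤ (2 * Real.pi)⁻¹))

theorem circle_mem {n : ℕ} {Ω : Set (Fin n → ℂ)} {a w : Fin n → ℂ}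
    (hd : ∀ ζ : ℂ, ‖ζ‖ ≤ 1 → a + ζ • w ∈ Ω) (θ : ℝ) :
    a + Complex.exp ((θ : ℂ) * Complex.I) • w ∈ Ω :=
  hd _ (Complex.norm_exp_ofReal_mul_I θ).le

theorem UpperSemicontinuousOn.measurable_circle {n : ℕ} {Ω : Set (Fin n → ℂ)}
    {v : (Fin n → ℂ) → ℝ} (hv : UpperSemicontinuousOn v Ω) {a w : Fin n → ℂ}
    (hd : ∀ ζ : ℂ, ‖ζ‖ ≤ 1 → a + ζ • w ∈ Ω) :
    Measurable fun θ : ℝ => v (a + Complex.exp ((θ : ℂ) * Complex.I) • w) := by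
  apply UpperSemicontinuous.measurable
  rw [← upperSemicontinuousOn_univ_iff]
  exact hv.comp (by fun_prop) fun θ _ => circle_mem hd θ

theorem UpperSemicontinuousOn.integrableOn_circle {n : ℕ} {Ω : Set (Fin n → ℂ)}
    {v : (Fin n → ℂ) → ℝ} (hv : UpperSemicontinuousOn v Ω) {M : ℝ} (hM : ∀ z ∈ Ω, |v z| ≤ M)
    {a w : Fin n → ℂ} (hd : ∀ ζ : ℂ, ‖ζ‖ ≤ 1 → a + ζ • w ∈ Ω) :
    IntegrableOn (fun θ : ℝ => v (a + Complex.exp ((θ : ℂ) * Complex.I) • w))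
      (Set.Ioc (0 : ℝ) (2 * Real.pi)) :=
  Measure.integrableOn_of_bounded (M := M) measure_Ioc_lt_top.ne (hv.measurable_circle hd).aestronglyMeasurable
    (ae_of_all _ fun θ => hM _ (circle_mem hd θ))

theorem isPSH_coe {n : ℕ} {Ω : Set (Fin n → ℂ)} {v : (Fin n → ℂ) → ℝ}
    (hv : UpperSemicontinuousOn v Ω) {M : ℝ} (hM : ∀ z ∈ Ω, |v z| ≤ M)
    (hm : ∀ a w : Fin n → ℂ, (∀ ζ : ℂ, ‖ζ‖ ≤ 1 → a + ζ • w ∈ Ω) →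
      v a ≤ angleMean fun θ => v (a + Complex.exp ((θ : ℂ) * Complex.I) • w)) :
    IsPSH Ω (fun z => (v z : EReal)) where
  lt_top z _ := EReal.coe_lt_top _
  usc := by
    intro z hz c hc
    induction c with
    | bot => simp at hc
    | top => exact Eventually.of_forall fun _ => EReal.coe_lt_top _
    | coe c => 
      filter_upwards [hv z hz c (EReal.coe_lt_coe_iff.1 hc)] with y hy
      exact EReal.coe_lt_coe_iff.2 hy
  le_circleMean a w hd := by
    rw [circleMean, extIntegral_coe (hv.integrableOn_circle hM hd), ← EReal.coe_mul]
    exact_mod_cast hm a w hd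

/-- Circle means of bounded upper semicontinuous functions depend upper semicontinuously on the
centre. -/
theorem le_angleMean_of_frequently {n : ℕ} {Ω : Set (Fin n → ℂ)} {v : (Fin n → ℂ) → ℝ}
    (hv : UpperSemicontinuousOn v Ω) {M : ℝ} (hM : ∀ z ∈ Ω, |v z| ≤ M)
    {a w : Fin n → ℂ} (hd : ∀ ζ : ℂ, ‖ζ‖ ≤ 1 → a + ζ • w ∈ Ω) {c : ℝ}
    (hc : ∃ᶠ z in 𝓝 a, (∀ ζ : ℂ, ‖ζ‖ ≤ 1 → z + ζ • w ∈ Ω) ∧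
      c ≤ angleMean fun θ => v (z + Complex.exp ((θ : ℂ) * Complex.I) • w)) :
    c ≤ angleMean fun θ => v (a + Complex.exp ((θ : ℂ) * Complex.I) • w) := by
  -- Fatou's lemma for the nonnegative functions `M - v` along a sequence of centres.
  obtain ⟨z, hza, hz⟩ := exists_seq_forall_of_frequently hc
  set μ := (volume : Measure ℝ).restrict (Set.Ioc (0 : ℝ) (2 * Real.pi)) with hμ
  have key : ∀ z : Fin n → ℂ, (∀ ζ : ℂ, ‖ζ‖ ≤ 1 → z + ζ • w ∈ Ω) →
      ∫⁻ θ, ENNReal.ofReal (M - v (z + Complex.exp ((θ : ℂ) * Complex.I) • w)) ∂μ =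
      ENNReal.ofReal (2 * Real.pi *
        (M - angleMean fun θ => v (z + Complex.exp ((θ : ℂ) * Complex.I) • w))) := by
    intro z hz
    have hi := hv.integrableOn_circle hM hz
    rw [← ofReal_integral_eq_lintegral_ofReal]
    · rw [integral_sub (integrable_const M) hi, angleMean]
      have hpi := Real.pi_pos
      rw [setIntegral_const, Real.volume_real_Ioc_of_le (by positivity), mul_sub,
        mul_inv_cancel_left₀ (by positivity)]
      simp
    · exact (integrable_const M).sub hi
    · exact ae_of_all _ fun θ => sub_nonneg.2 ((abs_le.1 (hM _ (circle_mem hz θ))).2)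
  have hpt : ∀ θ : ℝ, ENNReal.ofReal (M - v (a + Complex.exp ((θ : ℂ) * Complex.I) • w)) ≤
      liminf (fun k => ENNReal.ofReal
        (M - v (z k + Complex.exp ((θ : ℂ) * Complex.I) • w))) atTop := by
    intro θ
    refine le_of_forall_lt fun b hb => ?_
    obtain ⟨b', hb1, hb2⟩ := exists_between hb
    refine hb1.trans_le (le_liminf_of_le (by isBoundedDefault) ?_)
    have hb' : b' ≠ ⊤ := (hb2.trans ENNReal.ofReal_lt_top).ne
    rw [ENNReal.lt_ofReal_iff_toReal_lt hb'] at hb2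
    have ht : Tendsto (fun k => z k + Complex.exp ((θ : ℂ) * Complex.I) • w) atTop
        (𝓝[Ω] (a + Complex.exp ((θ : ℂ) * Complex.I) • w)) :=
      tendsto_nhdsWithin_iff.2 ⟨hza.add_const _,
        Eventually.of_forall fun k => circle_mem (hz k).1 θ⟩
    filter_upwards [ht.eventually (hv _ (circle_mem hd θ) (M - b'.toReal) (by linarith))] with k hk
    rw [← ENNReal.ofReal_toReal hb']
    exact ENNReal.ofReal_le_ofReal (by linarith)
  have hF : ENNReal.ofReal (2 * Real.pi *
        (M - angleMean fun θ => v (a + Complex.exp ((θ : ℂ) * Complex.I) • w))) ≤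
      ENNReal.ofReal (2 * Real.pi * (M - c)) := by
    rw [← key a hd]
    refine (lintegral_mono hpt).trans ((lintegral_liminf_le fun k => ?_).trans ?_)
    · exact ENNReal.measurable_ofReal.comp ((hv.measurable_circle (hz k).1).const_sub M)
    · refine liminf_le_of_frequently_le' (Frequently.of_forall fun k => ?_)
      rw [key _ (hz k).1]
      refine ENNReal.ofReal_le_ofReal ?_
      have := (hz k).2
      gcongr
  have hc0 : c ≤ M := (hz 0).2.trans (angleMean_le (hv.integrableOn_circle hM (hz 0).1)
    fun θ => (abs_le.1 (hM _ (circle_mem (hz 0).1 θ))).2)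
  rw [ENNReal.ofReal_le_ofReal_iff (by have := Real.pi_pos; nlinarith)] at hF
  have := le_of_mul_le_mul_left hF (by positivity)
  linarith

/-! ### The envelope is its own regularization. -/

theorem le_uscReg {n : ℕ} {Ω : Set (Fin n → ℂ)} (u : (Fin n → ℂ) → EReal) {z : Fin n → ℂ}
    (hz : z ∈ Ω) : u z ≤ uscReg Ω u z := by
  refine le_limsup_of_frequently_le' ?_
  rw [frequently_nhdsWithin_iff]
  exact fun h => h.self_of_nhds ⟨le_rfl, hz⟩

theorem uscReg_le {n : ℕ} {Ω : Set (Fin n → ℂ)} {u : (Fin n → ℂ) → EReal} {z : Fin n → ℂ}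
    (hu : UpperSemicontinuousWithinAt u Ω z) : uscReg Ω u z ≤ u z :=
  le_of_forall_gt_imp_ge_of_dense fun c hc =>
    limsup_le_of_le (by isBoundedDefault) ((hu c hc).mono fun _ h => h.le)

theorem uscReg_le_coe {n : ℕ} {Ω : Set (Fin n → ℂ)} {u : (Fin n → ℂ) → EReal}
    {φ : (Fin n → ℂ) → ℝ} (hφ : ContinuousOn φ Ω) (h : ∀ z ∈ Ω, u z ≤ (φ z : EReal))
    {z : Fin n → ℂ} (hz : z ∈ Ω) : uscReg Ω u z ≤ (φ z : EReal) := by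
  refine le_of_forall_gt_imp_ge_of_dense fun c hc => limsup_le_of_le (by isBoundedDefault) ?_
  have h1 : ContinuousWithinAt (fun y => (φ y : EReal)) Ω z :=
    continuous_coe_real_ereal.continuousAt.comp_continuousWithinAt (hφ z hz)
  filter_upwards [h1.eventually_lt_const hc, self_mem_nhdsWithin] with y hy hyΩ
  exact (h y hyΩ).trans hy.le

theorem upperSemicontinuousOn_uscReg {n : ℕ} {Ω : Set (Fin n → ℂ)} (u : (Fin n → ℂ) → EReal) :
    UpperSemicontinuousOn (uscReg Ω u) Ω := by
  intro z hz c hc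
  obtain ⟨b, hb1, hb2⟩ := exists_between hc
  have h : ∀ᶠ y in 𝓝[Ω] z, u y < b := eventually_lt_of_limsup_lt hb1
  filter_upwards [eventually_eventually_nhdsWithin.2 h] with y hy
  exact (limsup_le_of_le (by isBoundedDefault) (hy.mono fun _ h => h.le)).trans_lt hb2

theorem perronBremermann_le {n : ℕ} {Ω : Set (Fin n → ℂ)} {φ : (Fin n → ℂ) → ℝ} {z : Fin n → ℂ}
    (hz : z ∈ Ω) : perronBremermann Ω φ z ≤ φ z := by
  refine sSup_le ?_
  rintro _ ⟨u, -, hu, rfl⟩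
  exact (le_uscReg u hz).trans (hu z hz)

theorem IsPSH.le_perronBremermann {n : ℕ} {Ω : Set (Fin n → ℂ)} {φ : (Fin n → ℂ) → ℝ}
    {u : (Fin n → ℂ) → EReal} (hu : IsPSH Ω u) (h : ∀ z ∈ Ω, u z ≤ φ z) (z : Fin n → ℂ) :
    u z ≤ perronBremermann Ω φ z :=
  le_sSup ⟨u, hu, fun ζ hζ => (uscReg_le (hu.usc ζ hζ)).trans (h ζ hζ), rfl⟩

theorem UniformContinuousOn.exists_abs_le {n : ℕ} {Ω : Set (Fin n → ℂ)}
    (hbdd : Bornology.IsBounded Ω) {φ : (Fin n → ℂ) → ℝ} (hφ : UniformContinuousOn φ Ω) :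
    ∃ M : ℝ, ∀ z ∈ Ω, |φ z| ≤ M := by
  have h1 : TotallyBounded Ω := 
    (Bornology.IsBounded.isCompact_closure hbdd).totallyBounded.subset subset_closure
  have h2 : TotallyBounded (Set.univ : Set Ω) := by
    rw [← Subtype.coe_preimage_self]
    exact totallyBounded_preimage (isUniformInducing_val Ω) h1
  have h3 := (h2.image (uniformContinuousOn_iff_restrict.1 hφ)).isBounded
  obtain ⟨M, hM⟩ := h3.exists_norm_le
  exact ⟨M, fun z hz => hM _ ⟨⟨z, hz⟩, trivial, rfl⟩⟩

theorem angleMean_const (c : ℝ) : angleMean (fun _ => c) = c := by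
  have hpi := Real.pi_pos
  rw [angleMean, setIntegral_const, Real.volume_real_Ioc_of_le (by positivity)]
  simp
  field_simp

theorem eventually_disc_subset {n : ℕ} {Ω : Set (Fin n → ℂ)} (hΩ : IsOpen Ω) {a w : Fin n → ℂ}
    (hd : ∀ ζ : ℂ, ‖ζ‖ ≤ 1 → a + ζ • w ∈ Ω) :
    ∀ᶠ z in 𝓝 a, ∀ ζ : ℂ, ‖ζ‖ ≤ 1 → z + ζ • w ∈ Ω := by
  have hK : IsCompact (Metric.closedBall (0 : ℂ) 1) := isCompact_closedBall _ _
  have := hK.eventually_forall_of_forall_eventually (x₀ := a)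
    (P := fun z ζ => z + ζ • w ∈ Ω) fun ζ hζ => by
      have hc : Continuous fun p : (Fin n → ℂ) × ℂ => p.1 + p.2 • w := by fun_prop
      exact hc.continuousAt.eventually_mem (hΩ.mem_nhds (hd ζ (by simpa using hζ)))
  filter_upwards [this] with z hz ζ hζ using hz ζ (by simpa using hζ)

/-- The envelope of a bounded continuous function is real valued and plurisubharmonic. -/
theorem exists_isPSH_eq_perronBremermann {n : ℕ} {Ω : Set (Fin n → ℂ)} (hΩ : IsOpen Ω)
    {φ : (Fin n → ℂ) → ℝ} (hφ : ContinuousOn φ Ω) {M : ℝ} (hM : ∀ z ∈ Ω, |φ z| ≤ M) :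
    ∃ g : (Fin n → ℂ) → ℝ, (∀ z ∈ Ω, perronBremermann Ω φ z = g z) ∧
      UpperSemicontinuousOn g Ω ∧ (∀ z ∈ Ω, |g z| ≤ M) ∧ IsPSH Ω fun z => (g z : EReal) := by
  set P := perronBremermann Ω φ with hP
  have hPl : ∀ z, ((-M : ℝ) : EReal) ≤ P z := by
    refine (isPSH_coe (v := fun _ => -M) (M := |M|) upperSemicontinuousOn_const (by simp)
      fun a w _ => (angleMean_const _).ge).le_perronBremermann fun z hz => ?_
    exact EReal.coe_le_coe_iff.2 (abs_le.1 (hM z hz)).1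
  have hvφ : ∀ z ∈ Ω, uscReg Ω P z ≤ φ z := fun z hz =>
    uscReg_le_coe hφ (fun y hy => perronBremermann_le hy) hz
  set v : (Fin n → ℂ) → ℝ := fun z => (uscReg Ω P z).toReal with hv
  have hcoe : ∀ z ∈ Ω, uscReg Ω P z = v z := fun z hz => by
    refine (EReal.coe_toReal ?_ ?_).symm
    · exact ((hvφ z hz).trans_lt (EReal.coe_lt_top _)).ne
    · exact ((EReal.bot_lt_coe _).trans_le ((hPl z).trans (le_uscReg P hz))).ne'
  have hPv : ∀ z ∈ Ω, P z ≤ v z := fun z hz => (le_uscReg P hz).trans (hcoe z hz).le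
  have hvφ' : ∀ z ∈ Ω, v z ≤ φ z := fun z hz => by
    exact EReal.coe_le_coe_iff.1 ((hcoe z hz).symm.le.trans (hvφ z hz))
  have hvM : ∀ z ∈ Ω, |v z| ≤ M := fun z hz => abs_le.2
    ⟨EReal.coe_le_coe_iff.1 ((hPl z).trans (hPv z hz)), (hvφ' z hz).trans (abs_le.1 (hM z hz)).2⟩
  have husc : UpperSemicontinuousOn v Ω := by
    intro z hz c hc
    have h1 : uscReg Ω P z < (c : EReal) := by
      rw [hcoe z hz]; exact EReal.coe_lt_coe_iff.2 hc
    filter_upwards [upperSemicontinuousOn_uscReg P z hz _ h1, self_mem_nhdsWithin] with y hy hyΩ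
    rw [hcoe y hyΩ] at hy
    exact EReal.coe_lt_coe_iff.1 hy
  have hpsh : IsPSH Ω fun z => (v z : EReal) := by
    refine isPSH_coe husc hvM fun a w hd => ?_
    refine le_of_forall_lt_imp_le_of_dense fun c hc => ?_
    have ha : a ∈ Ω := by simpa using hd 0 (by simp)
    refine le_angleMean_of_frequently husc hvM hd ?_
    have h1 : (c : EReal) < limsup P (𝓝[Ω] a) := by
      change _ < uscReg Ω P a
      rw [hcoe a ha]; exact EReal.coe_lt_coe_iff.2 hc
    have h2 := (frequently_lt_of_lt_limsup (by isBoundedDefault) h1).filter_mono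
      nhdsWithin_le_nhds
    refine (h2.and_eventually (eventually_disc_subset hΩ hd)).mono ?_
    rintro z ⟨hz, hzd⟩
    refine ⟨hzd, ?_⟩
    -- One competitor exceeding `c` at the nearby centre `z` suffices: its circle values are at most
    -- those of `v`.
    obtain ⟨_, ⟨u, hu, huφ, rfl⟩, hcu⟩ := lt_sSup_iff.1 hz
    have h3 := hu.le_angleMean hzd (husc.integrableOn_circle hvM hzd) fun θ =>
      (hu.le_perronBremermann (φ := φ) (fun y hy => (le_uscReg u hy).trans (huφ y hy)) _).trans
        (hPv _ (circle_mem hzd θ))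
    exact EReal.coe_le_coe_iff.1 (hcu.le.trans h3)
  refine ⟨v, fun z hz => (hPv z hz).antisymm ?_, husc, hvM, hpsh⟩
  exact hpsh.le_perronBremermann (fun y hy => EReal.coe_le_coe_iff.2 (hvφ' y hy)) z

/-! ### The barrier and the maximum principle near a circle. -/

theorem angleMean_add_mul (a b : ℝ) {k : ℝ → ℝ} (hk : Continuous k) :
    angleMean (fun θ => a + b * k θ) = a + b * angleMean k := by
  have hi : IntegrableOn k (Set.Ioc (0 : ℝ) (2 * Real.pi)) := hk.integrableOn_Ioc
  have h := angleMean_const a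
  unfold angleMean at h ⊢
  rw [integral_add (integrable_const a) (hi.const_mul b), integral_const_mul, mul_add, h]
  ring

theorem angleMean_trig (c₀ c₁ c₂ c₃ c₄ c₅ : ℝ) :
    angleMean (fun θ => c₀ + c₁ * Real.cos θ + c₂ * Real.sin θ + c₃ * Real.cos θ ^ 2 +
      c₄ * (Real.sin θ * Real.cos θ) + c₅ * Real.sin θ ^ 2) = c₀ + (c₃ + c₅) / 2 := by
  have hi : ∀ k : ℝ → ℝ, Continuous k → IntervalIntegrable k volume 0 (2 * Real.pi) :=
    fun k hk => hk.intervalIntegrable _ _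
  have hpi := Real.pi_pos
  unfold angleMean
  rw [← intervalIntegral.integral_of_le (by positivity),
    intervalIntegral.integral_add (hi _ (by fun_prop)) (hi _ (by fun_prop)),
    intervalIntegral.integral_add (hi _ (by fun_prop)) (hi _ (by fun_prop)),
    intervalIntegral.integral_add (hi _ (by fun_prop)) (hi _ (by fun_prop)),
    intervalIntegral.integral_add (hi _ (by fun_prop)) (hi _ (by fun_prop)),
    intervalIntegral.integral_add (hi _ (by fun_prop)) (hi _ (by fun_prop))]
  simp only [intervalIntegral.integral_const_mul, integral_cos, integral_sin, integral_cos_sq,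
    integral_sin_sq, integral_sin_mul_cos₁, intervalIntegral.integral_const]
  simp
  field_simp
  ring

/-- A function on `ℂ` near `1` that is strictly superharmonic, nonnegative on the circle
`|z| = x`, and at least `1` on the part of the circle `|z - 1| = ρ` that lies on one side of it. -/
noncomputable def barrier (σ x ρ : ℝ) (z : ℂ) : ℝ :=
  24 / ρ * (σ * (x ^ 2 - Complex.normSq z)) - 4 / ρ ^ 2 * (Complex.normSq z - x ^ 2) ^ 2 +
    4 / ρ ^ 2 * z.im ^ 2

theorem continuous_barrier (σ x ρ : ℝ) : Continuous (barrier σ x ρ) := by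
  unfold barrier
  have := Complex.continuous_normSq
  fun_prop

theorem barrier_nonneg {σ x ρ : ℝ} {z : ℂ} (hz : Complex.normSq z = x ^ 2) :
    0 ≤ barrier σ x ρ z := by
  rw [barrier, hz]
  simp
  positivity

theorem barrier_one_le {σ x ρ κ : ℝ} (hσ : |σ| = 1) (hρ : 0 < ρ) (hx : |x - 1| ≤ κ)
    (hκ : κ ≤ 1) : barrier σ x ρ 1 ≤ 72 * κ / ρ := by
  obtain ⟨h1, h2⟩ := abs_le.1 hx
  have h3 : σ * (x ^ 2 - 1) ≤ 3 * κ := by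
    refine (le_abs_self _).trans ?_
    rw [abs_mul, hσ, one_mul, abs_le]
    constructor <;> nlinarith
  have h4 : 0 ≤ 4 / ρ ^ 2 * (1 - x ^ 2) ^ 2 := by positivity
  have h5 : 24 / ρ * (σ * (x ^ 2 - 1)) ≤ 24 / ρ * (3 * κ) := by gcongr
  have h6 : 24 / ρ * (3 * κ) = 72 * κ / ρ := by ring
  simp [barrier]
  linarith

/-- On the outer arc either `z.im` is large and the last term alone gives 1, or `z.re - 1` is large;
then so is the distance of `normSq z` from `x ^ 2`, and the linear term beats the quadratic one. -/
theorem one_le_barrier {σ x ρ κ : ℝ} (hσ : |σ| = 1) (hρ : 0 < ρ) (hρ' : ρ ≤ 1 / 16)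
    (hx : |x - 1| ≤ κ) (hκ : κ ≤ ρ / 30) {z : ℂ} (hz : ‖z - 1‖ = ρ)
    (hz' : 0 ≤ σ * (x ^ 2 - Complex.normSq z)) : 1 ≤ barrier σ x ρ z := by
  obtain ⟨h1, h2⟩ := abs_le.1 hx
  have hsq : (z.re - 1) ^ 2 + z.im ^ 2 = ρ ^ 2 := by
    rw [← hz, ← Complex.normSq_eq_norm_sq, Complex.normSq_apply]
    simp
    ring
  have hN : Complex.normSq z = 2 * (z.re - 1) + 1 + ρ ^ 2 := by
    rw [← hsq, Complex.normSq_apply]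
    ring
  set D := 4 / ρ ^ 2 with hD
  have hDρ : D * ρ ^ 2 = 4 := by rw [hD]; field_simp
  have hDpos : 0 < D := by positivity
  have hB : 24 / ρ = 6 * D * ρ := by rw [hD]; field_simp; norm_num
  set t := σ * (x ^ 2 - Complex.normSq z) with ht
  have htabs : t = |x ^ 2 - Complex.normSq z| := by
    rw [← abs_of_nonneg hz', ht, abs_mul, hσ, one_mul]
  have htsq : (Complex.normSq z - x ^ 2) ^ 2 = t ^ 2 := by
    rw [htabs, sq_abs]; ring
  have hρsq : ρ ^ 2 ≤ ρ / 16 := by nlinarith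
  have hx2 : |1 - x ^ 2| ≤ ρ / 10 := by
    have : κ ^ 2 ≤ κ := by nlinarith
    rw [abs_le]; constructor <;> nlinarith only [h1, h2, this, hκ]
  obtain ⟨h3, h4⟩ := abs_le.1 hx2
  have hs : |z.re - 1| ≤ ρ := abs_le_of_sq_le_sq (by nlinarith [sq_nonneg z.im]) hρ.le
  obtain ⟨h5, h6⟩ := abs_le.1 hs
  have htle : t ≤ 2.2 * ρ := by
    rw [htabs, hN, abs_le]; constructor <;> linarith [sq_nonneg ρ]
  have hmain : 3.8 * D * ρ * t ≤ 6 * D * ρ * t - D * t ^ 2 := by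
    nlinarith [mul_nonneg (mul_nonneg hDpos.le hz') (sub_nonneg.2 htle)]
  have hb : barrier σ x ρ z = 6 * D * ρ * t - D * t ^ 2 + D * z.im ^ 2 := by
    rw [barrier, ← hD, hB, htsq]
  rw [hb]
  have h0 : 0 ≤ 3.8 * D * ρ * t := by positivity
  by_cases hy : ρ ^ 2 / 4 ≤ z.im ^ 2
  · have : D * (ρ ^ 2 / 4) ≤ D * z.im ^ 2 := by gcongr
    linarith
  · have h7 : 0.8 * ρ ≤ |z.re - 1| := by
      refine le_of_sq_le_sq ?_ (abs_nonneg _)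
      rw [sq_abs]
      push Not at hy
      nlinarith
    have h8 : 1.4 * ρ ≤ t := by
      rw [htabs, hN]
      rcases le_abs.1 h7 with h | h
      · refine le_trans ?_ (neg_le_abs _); linarith [sq_nonneg ρ]
      · refine le_trans ?_ (le_abs_self _); linarith [sq_nonneg ρ]
    have h9 : 3.8 * D * ρ * (1.4 * ρ) ≤ 3.8 * D * ρ * t := by gcongr
    have h10 : 0 ≤ D * z.im ^ 2 := by positivity
    have h11 : 3.8 * D * ρ * (1.4 * ρ) = 5.32 * (D * ρ ^ 2) := by ring
    linarith

/-- `normSq` is affine in `cos θ`, `sin θ` on a circle, so the mean is computed exactly. The squared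
term makes it drop, outweighing `z.im ^ 2`, and for `ρ ≤ 1 / 16` also the first term, whose sign
depends on `σ`. -/
theorem angleMean_barrier_lt {σ x ρ κ : ℝ} (hσ : |σ| = 1) (hρ : 0 < ρ) (hρ' : ρ ≤ 1 / 16)
    (hx : |x - 1| ≤ κ) (hκ : κ ≤ ρ / 30) {p : ℂ} (hp : ‖p - 1‖ ≤ ρ) {r : ℝ} (hr : 0 < r) :
    angleMean (fun θ => barrier σ x ρ (p + Complex.exp ((θ : ℂ) * Complex.I) * r)) <
      barrier σ x ρ p := by
  obtain ⟨h1, h2⟩ := abs_le.1 hx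
  set D := 4 / ρ ^ 2 with hD
  have hDρ : D * ρ ^ 2 = 4 := by rw [hD]; field_simp
  have hDpos : 0 < D := by positivity
  have hB : 24 / ρ = 6 * D * ρ := by rw [hD]; field_simp; norm_num
  set s := p.re with hs
  set y := p.im with hy
  set A := s ^ 2 + y ^ 2 - x ^ 2 + r ^ 2 with hA
  have hk : (fun θ : ℝ => barrier σ x ρ (p + Complex.exp ((θ : ℂ) * Complex.I) * r)) =
      fun θ => (-(6 * D * ρ) * σ * A - D * A ^ 2 + D * y ^ 2) +
        (-(2 * r * (6 * D * ρ) * σ * s) - 4 * D * A * r * s) * Real.cos θ +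
        (-(2 * r * (6 * D * ρ) * σ * y) - 4 * D * A * r * y + 2 * D * y * r) * Real.sin θ +
        (-(4 * D * r ^ 2 * s ^ 2)) * Real.cos θ ^ 2 +
        (-(8 * D * r ^ 2 * s * y)) * (Real.sin θ * Real.cos θ) +
        (-(4 * D * r ^ 2 * y ^ 2) + D * r ^ 2) * Real.sin θ ^ 2 := by
    funext θ
    have hN : Complex.normSq (p + Complex.exp ((θ : ℂ) * Complex.I) * r) =
        A + x ^ 2 + 2 * r * (s * Real.cos θ + y * Real.sin θ) := by
      rw [Complex.normSq_apply]
      simp [Complex.exp_ofReal_mul_I_re, Complex.exp_ofReal_mul_I_im]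
      linear_combination r ^ 2 * Real.cos_sq_add_sin_sq θ
    have hI : (p + Complex.exp ((θ : ℂ) * Complex.I) * r).im = y + r * Real.sin θ := by
      simp [Complex.exp_ofReal_mul_I_im]
      ring
    rw [barrier, ← hD, hB, hN, hI]
    ring
  have hq : barrier σ x ρ p = -(6 * D * ρ) * σ * (A - r ^ 2) - D * (A - r ^ 2) ^ 2 + D * y ^ 2 := by
    rw [barrier, ← hD, hB, Complex.normSq_apply]
    ring
  rw [hk, angleMean_trig, hq]
  have hs1 : 1 - ρ ≤ s := by
    have := (abs_le.1 ((Complex.abs_re_le_norm (p - 1)).trans hp)).1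
    simp at this
    linarith
  have hTN : 0.7 ≤ 2 * (s ^ 2 + y ^ 2) - x ^ 2 := by nlinarith [sq_nonneg y]
  have hσ1 : -1 ≤ σ := (abs_le.1 hσ.le).1
  have hfin : 0 < r ^ 2 * D * (6 * ρ * σ + 2 * (2 * (s ^ 2 + y ^ 2) - x ^ 2) - 1 / 2 + r ^ 2) := by
    apply mul_pos (by positivity)
    nlinarith [sq_nonneg r]
  nlinarith

/-- A bounded subharmonic function near `1` that varies little under small rotations has at
nearby points values not much below its value at `1`. -/
theorem exists_forall_le_of_rotation {M ρ₀ η ε : ℝ} (hM : 0 ≤ M) (hρ₀ : 0 < ρ₀) (hη : 0 < η)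
    (hε : 0 < ε) : ∃ κ > 0, ∀ (f : ℂ → ℝ) (τ : ℝ), 0 ≤ τ →
      UpperSemicontinuousOn f (Metric.closedBall 1 ρ₀) →
      (∀ z ∈ Metric.closedBall (1 : ℂ) ρ₀, |f z| ≤ M) →
      (∀ (p : ℂ) (r : ℝ), 0 < r → Metric.closedBall p r ⊆ Metric.closedBall 1 ρ₀ →
        ∀ k : ℝ → ℝ, Continuous k →
          (∀ θ : ℝ, f (p + Complex.exp ((θ : ℂ) * Complex.I) * r) ≤ k θ) → f p ≤ angleMean k) →
      (∀ t z : ℂ, ‖t‖ = 1 → ‖t - 1‖ ≤ η → z ∈ Metric.closedBall (1 : ℂ) ρ₀ →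
        t * z ∈ Metric.closedBall (1 : ℂ) ρ₀ → f (t * z) ≤ f z + τ) →
      ∀ z : ℂ, ‖z - 1‖ < κ → f 1 ≤ f z + τ + ε := by
  set ρ := min ρ₀ (min (η / 4) (1 / 16)) with hρdef
  have hρ : 0 < ρ := by positivity
  have hρ1 : ρ ≤ ρ₀ := min_le_left _ _
  have hρ2 : ρ ≤ η / 4 := (min_le_right _ _).trans (min_le_left _ _)
  have hρ3 : ρ ≤ 1 / 16 := (min_le_right _ _).trans (min_le_right _ _)
  -- As `-M ≤ m` below, `m + L` exceeds every value of `f`, which settles the outer arc.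
  set L := 2 * M + 1 with hL
  have hLpos : 0 < L := by positivity
  refine ⟨min (ρ / 30) (ε * ρ / (72 * L)), by positivity, ?_⟩
  intro f τ hτ husc hbd hsub hrot ζ hζ
  set κ := min (ρ / 30) (ε * ρ / (72 * L)) with hκ
  have hκ1 : κ ≤ ρ / 30 := min_le_left _ _
  have hκ2 : κ ≤ ε * ρ / (72 * L) := min_le_right _ _
  set x := ‖ζ‖ with hx
  have hx1 : |x - 1| ≤ κ := by
    have := abs_norm_sub_norm_le ζ 1
    rw [norm_one] at this
    exact this.trans hζ.le
  -- The sign selects the side of the circle `|z| = x` that contains 1.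
  obtain ⟨σ, hσ, hσ1⟩ : ∃ σ : ℝ, |σ| = 1 ∧ 0 ≤ σ * (x ^ 2 - Complex.normSq 1) := by
    rcases le_total 0 (x ^ 2 - Complex.normSq 1) with h | h
    · exact ⟨1, by simp, by linarith⟩
    · exact ⟨-1, by simp, by linarith⟩
  have hζmem : ζ ∈ Metric.closedBall (1 : ℂ) ρ₀ := by
    rw [mem_closedBall_iff_norm]; linarith
  set m := f ζ + τ with hm
  set F : ℂ → ℝ := fun z => f z + -(m + L * barrier σ x ρ z) with hF
  set K : Set ℂ := Metric.closedBall 1 ρ ∩ {z | 0 ≤ σ * (x ^ 2 - Complex.normSq z)} with hK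
  have hcN : Continuous fun z : ℂ => σ * (x ^ 2 - Complex.normSq z) := by
    have := Complex.continuous_normSq
    fun_prop
  have hcq := continuous_barrier σ x ρ
  have hKc : IsCompact K :=
    (isCompact_closedBall _ _).inter_right (isClosed_le continuous_const hcN)
  have h1K : (1 : ℂ) ∈ K := ⟨Metric.mem_closedBall_self hρ.le, hσ1⟩
  have hK0 : K ⊆ Metric.closedBall 1 ρ₀ := fun z hz => Metric.closedBall_subset_closedBall hρ1 hz.1
  have hFusc : UpperSemicontinuousOn F K :=
    (husc.mono hK0).add (by
      have : Continuous fun z => -(m + L * barrier σ x ρ z) := by fun_prop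
      exact this.upperSemicontinuous.upperSemicontinuousOn K)
  obtain ⟨p, hpK, hpmax⟩ := hFusc.exists_isMaxOn ⟨1, h1K⟩ hKc
  have hmM : -M ≤ m := by have := (abs_le.1 (hbd ζ hζmem)).1; linarith
  have hFp : F p ≤ 0 := by
    by_cases hb : ‖p - 1‖ = ρ
    · have h1 := one_le_barrier hσ hρ hρ3 hx1 hκ1 hb hpK.2
      have h2 := (abs_le.1 (hbd p (hK0 hpK))).2
      have h3 : L * 1 ≤ L * barrier σ x ρ p := by gcongr
      simp only [hF]
      linarith
    by_cases hc : Complex.normSq p = x ^ 2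
    · have h1 : 0 ≤ L * barrier σ x ρ p := mul_nonneg hLpos.le (barrier_nonneg hc)
      have hζ0 : 0.9 ≤ ‖ζ‖ := by have := (abs_le.1 hx1).1; linarith
      have hζne : ζ ≠ 0 := by
        rintro rfl; norm_num at hζ0
      have hpζ : p = p / ζ * ζ := by field_simp
      have hnorm : ‖p‖ = ‖ζ‖ := by
        rw [Complex.normSq_eq_norm_sq] at hc
        exact (sq_eq_sq₀ (norm_nonneg _) (norm_nonneg _)).1 hc
      have h2 : f p ≤ m := by
        rw [hpζ]
        refine hrot _ _ ?_ ?_ hζmem (hpζ ▸ hK0 hpK)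
        · rw [norm_div, hnorm, div_self (by linarith)]
        · rw [div_sub_one hζne, norm_div, div_le_iff₀ (by linarith)]
          have h3 : ‖p - ζ‖ ≤ ‖p - 1‖ + ‖ζ - 1‖ := by
            rw [← norm_neg (ζ - 1)]
            refine le_trans (le_of_eq ?_) (norm_add_le _ _)
            ring_nf
          have h4 := mem_closedBall_iff_norm.1 hpK.1
          nlinarith
      simp only [hF]
      linarith
    -- At an interior maximum the sub-mean value inequality for `f` contradicts the strict
    -- superharmonicity of the barrier.
    · exfalso
      have hnear : K ∈ 𝓝 p := by
        refine inter_mem ?_ ?_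
        · refine Metric.closedBall_mem_nhds_of_mem ?_
          rw [mem_ball_iff_norm]
          exact lt_of_le_of_ne (mem_closedBall_iff_norm.1 hpK.1) hb
        · have h0 : 0 < σ * (x ^ 2 - Complex.normSq p) := by
            refine lt_of_le_of_ne hpK.2 (Ne.symm (mul_ne_zero ?_ (sub_ne_zero.2 (Ne.symm hc))))
            rintro rfl; simp at hσ
          filter_upwards [hcN.continuousAt.eventually_const_lt h0] with z hz using hz.le
      obtain ⟨r, hr, hrK⟩ := Metric.nhds_basis_closedBall.mem_iff.1 hnear
      have hcirc : Continuous fun θ : ℝ =>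
          barrier σ x ρ (p + Complex.exp ((θ : ℂ) * Complex.I) * r) := by fun_prop
      have h1 := hsub p r hr (hrK.trans hK0)
        (fun θ => (F p + m) + L * barrier σ x ρ (p + Complex.exp ((θ : ℂ) * Complex.I) * r))
        (by fun_prop) fun θ => by
          have hin : p + Complex.exp ((θ : ℂ) * Complex.I) * r ∈ K := hrK (by
            simp [Complex.norm_exp_ofReal_mul_I, abs_of_pos hr])
          have := hpmax hin
          simp only [hF, Set.mem_ofPred_eq] at this ⊢
          linarith
      rw [angleMean_add_mul _ _ hcirc] at h1
      have h2 := angleMean_barrier_lt hσ hρ hρ3 hx1 hκ1 (mem_closedBall_iff_norm.1 hpK.1) hr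
      have h3 := mul_lt_mul_of_pos_left h2 hLpos
      simp only [hF] at h1
      linarith
  have h1 : F 1 ≤ F p := hpmax h1K
  have h2 : L * barrier σ x ρ 1 ≤ ε := by
    have h3 := barrier_one_le hσ hρ hx1 (by linarith)
    calc L * barrier σ x ρ 1 ≤ L * (72 * (ε * ρ / (72 * L)) / ρ) := by
          refine mul_le_mul_of_nonneg_left (h3.trans ?_) hLpos.le
          gcongr
      _ = ε := by field_simp
  simp only [hF] at h1
  linarith

/-! ### Small rotations and lower semicontinuity. -/

theorem angleMean_add_indicator (S c : ℝ) {η : ℝ} (hη : 0 ≤ η) (hη' : η ≤ 2 * Real.pi) :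
    IntegrableOn (fun θ => S + (Set.Ioc 0 η).indicator (fun _ => c) θ)
      (Set.Ioc (0 : ℝ) (2 * Real.pi)) ∧
    angleMean (fun θ => S + (Set.Ioc 0 η).indicator (fun _ => c) θ) =
      S + η / (2 * Real.pi) * c := by
  have hi : IntegrableOn ((Set.Ioc 0 η).indicator fun _ => c) (Set.Ioc (0 : ℝ) (2 * Real.pi)) :=
    (integrable_const c).indicator measurableSet_Ioc
  refine ⟨(integrable_const S).add hi, ?_⟩
  have h := angleMean_const S
  unfold angleMean at h ⊢
  rw [integral_add (integrable_const S) hi, mul_add, h, setIntegral_indicator measurableSet_Ioc,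
    Set.inter_eq_right.2 (Set.Ioc_subset_Ioc_right hη'), setIntegral_const,
    Real.volume_real_Ioc_of_le hη]
  simp
  ring

theorem update_add_smul_single {n : ℕ} (p : Fin n → ℂ) (j : Fin n) (b c ζ : ℂ) :
    Function.update p j b + ζ • Pi.single j c = Function.update p j (b + ζ * c) := by
  ext i
  rcases eq_or_ne i j with rfl | h <;> simp [*]

theorem update_mem_ball {n : ℕ} {a p : Fin n → ℂ} {R : ℝ} (hp : p ∈ Metric.ball a R) {j : Fin n}
    {c : ℂ} (hc : ‖c - a j‖ < R) : Function.update p j c ∈ Metric.ball a R := by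
  have hR : 0 < R := Metric.pos_of_mem_ball hp
  rw [Metric.mem_ball, dist_pi_lt_iff hR] at hp ⊢
  intro i
  rcases eq_or_ne i j with rfl | h
  · simpa [dist_eq_norm] using hc
  · simpa [h] using hp i

theorem piecewise_mem_ball {n : ℕ} {a z : Fin n → ℂ} {R : ℝ} (hz : z ∈ Metric.ball a R)
    (s : Finset (Fin n)) : s.piecewise z a ∈ Metric.ball a R := by
  have hR : 0 < R := Metric.pos_of_mem_ball hz
  rw [Metric.mem_ball, dist_pi_lt_iff hR] at hz ⊢
  intro i
  by_cases h : i ∈ s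
  · simpa [h] using hz i
  · simpa [h] using hR

theorem exists_rotation_modulus {n : ℕ} {Ω : Set (Fin n → ℂ)} (hΩ : IsReinhardtDomain Ω)
    (hbdd : Bornology.IsBounded Ω) {φ : (Fin n → ℂ) → ℝ} (hφ : UniformContinuousOn φ Ω)
    {g : (Fin n → ℂ) → ℝ} (hg : ∀ z ∈ Ω, perronBremermann Ω φ z = g z)
    (husc : UpperSemicontinuousOn g Ω) {M : ℝ} (hM : ∀ z ∈ Ω, |g z| ≤ M)
    (hpsh : IsPSH Ω fun z => (g z : EReal)) {τ : ℝ} (hτ : 0 < τ) :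
    ∃ η > 0, ∀ (j : Fin n) (t : ℂ), ‖t‖ = 1 → ‖t - 1‖ ≤ η → ∀ z ∈ Ω,
      Function.update z j (t * z j) ∈ Ω ∧ g (Function.update z j (t * z j)) ≤ g z + τ := by
  obtain ⟨δ, hδ, hφδ⟩ := Metric.uniformContinuousOn_iff.1 hφ τ hτ
  obtain ⟨R, hR⟩ : ∃ R, ∀ z ∈ Ω, ‖z‖ ≤ R := Bornology.IsBounded.exists_norm_le hbdd
  obtain ⟨z₀, hz₀⟩ := hΩ.isConnected.nonempty
  have hR0 : 0 ≤ R := (norm_nonneg _).trans (hR z₀ hz₀)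
  -- A rotation by `t` moves a coordinate by at most `‖t - 1‖ * R`; the `+ 1` covers `R = 0`.
  refine ⟨δ / (R + 1), by positivity, fun j t ht ht1 => ?_⟩
  set s : Fin n → ℂ := Function.update 1 j t with hs
  have hsz : ∀ z : Fin n → ℂ, Function.update z j (t * z j) = s * z := fun z => by
    ext i
    rcases eq_or_ne i j with rfl | h <;> simp [*]
  have hmem : ∀ z ∈ Ω, s * z ∈ Ω := fun z hz => hΩ.torus_mul_mem z hz s fun i => by
    rcases eq_or_ne i j with rfl | h <;> simp [*]
  have hdist : ∀ z ∈ Ω, dist (s * z) z < δ := fun z hz => by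
    rw [dist_pi_lt_iff hδ]
    intro i
    rcases eq_or_ne i j with rfl | h
    · have h1 : dist ((s * z) i) (z i) = ‖t - 1‖ * ‖z i‖ := by
        rw [dist_eq_norm, ← norm_mul]
        simp [hs, sub_mul]
      rw [h1]
      calc ‖t - 1‖ * ‖z i‖ ≤ δ / (R + 1) * R := by
            gcongr
            exact (norm_le_pi_norm z i).trans (hR z hz)
        _ < δ / (R + 1) * (R + 1) := by gcongr; linarith
        _ = δ := by field_simp
    · simpa [hs, h] using hδ
  have hgφ : ∀ z ∈ Ω, g z ≤ φ z := fun z hz => by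
    have := perronBremermann_le (φ := φ) hz
    rw [hg z hz] at this
    exact EReal.coe_le_coe_iff.1 this
  have hcirc : ∀ (a w : Fin n → ℂ) (ζ : ℂ), s * (a + ζ • w) = s * a + ζ • (s * w) :=
    fun a w ζ => by rw [mul_add, mul_smul_comm]
  have hvusc : UpperSemicontinuousOn (fun z => g (s * z) + -τ) Ω :=
    (husc.comp (g := fun z => s * z) (by fun_prop) hmem).add upperSemicontinuousOn_const
  have hv : IsPSH Ω fun z => ((g (s * z) + -τ : ℝ) : EReal) := by
    refine isPSH_coe (M := M + τ) hvusc (fun z hz => ?_) fun a w hd => ?_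
    · refine (abs_add_le _ _).trans ?_
      rw [abs_neg, abs_of_pos hτ]
      linarith [hM _ (hmem z hz)]
    · have hd' : ∀ ζ : ℂ, ‖ζ‖ ≤ 1 → s * a + ζ • (s * w) ∈ Ω := fun ζ hζ => by
        rw [← hcirc]; exact hmem _ (hd ζ hζ)
      have hi := husc.integrableOn_circle hM hd'
      have h1 := EReal.coe_le_coe_iff.1 (hpsh.le_angleMean hd' hi fun θ => le_rfl)
      have h2 := angleMean_const (-τ)
      simp only [hcirc]
      unfold angleMean at h1 h2 ⊢
      rw [integral_add hi (integrable_const _), mul_add, h2]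
      linarith
  intro z hz
  rw [hsz]
  refine ⟨hmem z hz, ?_⟩
  have h1 := hv.le_perronBremermann (φ := φ) (fun y hy => by
    refine EReal.coe_le_coe_iff.2 ?_
    have h2 := hφδ _ (hmem y hy) _ hy (hdist y hy)
    rw [Real.dist_eq] at h2
    linarith [hgφ _ (hmem y hy), (abs_lt.1 h2).2]) z
  rw [hg z hz] at h1
  linarith [EReal.coe_le_coe_iff.1 h1]

/-- The circle values are majorized by `m` on the arc of angles in `(0, η]` and by `S` elsewhere;
that arc has share `η / (2π)` of the circle. -/
theorem lower_bound_of_coord_zero {n : ℕ} {Ω : Set (Fin n → ℂ)} {g : (Fin n → ℂ) → ℝ}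
    (hpsh : IsPSH Ω fun z => (g z : EReal)) {p : Fin n → ℂ} {j : Fin n} (hp : p j = 0) {c : ℂ}
    {S m η : ℝ} (hη : 0 ≤ η) (hη' : η ≤ 1)
    (hd : ∀ ζ : ℂ, ‖ζ‖ ≤ 1 → Function.update p j (ζ * c) ∈ Ω)
    (hS : ∀ t : ℂ, ‖t‖ = 1 → g (Function.update p j (t * c)) ≤ S)
    (hm : ∀ t : ℂ, ‖t‖ = 1 → ‖t - 1‖ ≤ η → g (Function.update p j (t * c)) ≤ m) :
    g p ≤ S + η / (2 * Real.pi) * (m - S) := by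
  have hu : ∀ ζ : ℂ, p + ζ • Pi.single j c = Function.update p j (ζ * c) := fun ζ => by
    have h := update_add_smul_single p j (p j) c ζ
    rwa [Function.update_eq_self, hp, zero_add] at h
  obtain ⟨hi, hmean⟩ := angleMean_add_indicator S (m - S) hη
    (hη'.trans (by linarith [Real.pi_gt_three]))
  rw [← hmean]
  refine EReal.coe_le_coe_iff.1 (hpsh.le_angleMean (w := Pi.single j c)
    (fun ζ hζ => (hu ζ).symm ▸ hd ζ hζ) hi fun θ => EReal.coe_le_coe_iff.2 ?_)
  rw [hu]
  have hn : ‖Complex.exp ((θ : ℂ) * Complex.I)‖ = 1 := Complex.norm_exp_ofReal_mul_I θ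
  by_cases hθ : θ ∈ Set.Ioc 0 η
  · rw [Set.indicator_of_mem hθ, add_sub_cancel]
    refine hm _ hn ?_
    rw [mul_comm]
    refine Real.norm_exp_I_mul_ofReal_sub_one_le.trans ?_
    rw [Real.norm_eq_abs, abs_of_pos hθ.1]
    exact hθ.2
  · rw [Set.indicator_of_notMem hθ, add_zero]
    exact hS _ hn

theorem eventually_norm_div_sub_one_lt {n : ℕ} {a : Fin n → ℂ} {j : Fin n} (haj : a j ≠ 0)
    {κ : ℝ} (hκ : 0 < κ) : ∀ᶠ z in 𝓝 a, ‖z j / a j - 1‖ < κ := by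
  have h1 : Continuous fun z : Fin n → ℂ => z j := continuous_apply j
  have h2 : Continuous fun w : ℂ => ‖w / a j - 1‖ := by fun_prop
  refine (h2.comp h1).continuousAt.eventually_lt_const ?_
  simpa [haj] using hκ

/-- A bounded plurisubharmonic function that varies little under small rotations of the
coordinates is lower semicontinuous. -/
theorem IsPSH.eventually_sub_le {n : ℕ} {Ω : Set (Fin n → ℂ)} (hΩ : IsOpen Ω)
    {g : (Fin n → ℂ) → ℝ} (husc : UpperSemicontinuousOn g Ω) {M : ℝ} (hM : ∀ z ∈ Ω, |g z| ≤ M)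
    (hpsh : IsPSH Ω fun z => (g z : EReal))
    (hrot : ∀ τ > 0, ∃ η > 0, ∀ (j : Fin n) (t : ℂ), ‖t‖ = 1 → ‖t - 1‖ ≤ η → ∀ z ∈ Ω,
      Function.update z j (t * z j) ∈ Ω ∧ g (Function.update z j (t * z j)) ≤ g z + τ)
    {a : Fin n → ℂ} (ha : a ∈ Ω) (s : Finset (Fin n)) :
    ∀ δ > 0, ∀ᶠ z in 𝓝 a, g a - δ ≤ g (s.piecewise z a) := by
  have hM0 : 0 ≤ M := (abs_nonneg _).trans (hM a ha)
  induction s using Finset.induction_on with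
  | empty => intro δ hδ; simp [hδ.le]
  | insert j s hj ih =>
    intro δ hδ
    by_cases haj : a j = 0
    · obtain ⟨η', hη', hr⟩ := hrot (δ / 2) (by positivity)
      set η := min η' 1 with hηdef
      have hη : 0 < η := by positivity
      set c := η / (2 * Real.pi) with hc
      have hcpos : 0 < c := by have := Real.pi_pos; positivity
      -- The tolerance scales with the arc's share `c`, because the final inequality is divided by
      -- `c`.
      have h1 : ∀ᶠ z in 𝓝 a, g z < g a + c * δ / 4 := by
        have := husc a ha (g a + c * δ / 4) (by linarith [mul_pos hcpos hδ])
        rwa [hΩ.nhdsWithin_eq ha] at this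
      obtain ⟨R, hR, hball⟩ := Metric.eventually_nhds_iff_ball.1
        (h1.and (hΩ.eventually_mem ha))
      filter_upwards [ih (c * δ / 4) (by positivity), Metric.ball_mem_nhds a hR] with z hz hzR
      rw [Finset.piecewise_insert]
      set p := s.piecewise z a with hp
      have hpR : p ∈ Metric.ball a R := piecewise_mem_ball hzR s
      have hpj : p j = 0 := by simp [hp, hj, haj]
      have hzj : ‖z j‖ < R := by
        have := (dist_pi_lt_iff hR).1 hzR j
        rwa [haj, dist_zero_right] at this
      have hmem : ∀ ζ : ℂ, ‖ζ‖ ≤ 1 → Function.update p j (ζ * z j) ∈ Metric.ball a R :=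
        fun ζ hζ => update_mem_ball hpR (by
          rw [haj, sub_zero, norm_mul]
          exact (mul_le_of_le_one_left (norm_nonneg _) hζ).trans_lt hzj)
      have hp' : Function.update p j (z j) ∈ Ω := by
        simpa using (hball _ (hmem 1 (by simp))).2
      have key := lower_bound_of_coord_zero hpsh hpj (c := z j) (S := g a + c * δ / 4)
        (m := g (Function.update p j (z j)) + δ / 2) hη.le (min_le_right _ _)
        (fun ζ hζ => (hball _ (hmem ζ hζ)).2) (fun t ht => (hball _ (hmem t ht.le)).1.le)
        (fun t ht ht1 => by
          simpa using (hr j t ht (ht1.trans (min_le_left _ _)) _ hp').2)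
      rw [← hc] at key
      have h3 : c * (g a - δ) ≤ c * g (Function.update p j (z j)) := by
        nlinarith [mul_pos hcpos (mul_pos hcpos hδ)]
      exact le_of_mul_le_mul_left h3 hcpos
    · obtain ⟨η, hη, hr⟩ := hrot (δ / 3) (by positivity)
      have haj' : 0 < ‖a j‖ := norm_pos_iff.2 haj
      obtain ⟨R, hR, hball⟩ := Metric.isOpen_iff.1 hΩ a ha
      -- After scaling by `a j` the disc has radius `R / 2`, inside the ball of radius `R`.
      set ρ₀ := R / (2 * ‖a j‖) with hρ₀
      obtain ⟨κ, hκ, hbar⟩ := exists_forall_le_of_rotation (M := M) (ρ₀ := ρ₀) (η := η)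
        (ε := δ / 3) hM0 (by positivity) hη (by positivity)
      filter_upwards [ih (δ / 3) (by positivity), Metric.ball_mem_nhds a hR,
        eventually_norm_div_sub_one_lt haj hκ]
        with z hz hzR hzj
      rw [Finset.piecewise_insert]
      set p := s.piecewise z a with hp
      have hpR : p ∈ Metric.ball a R := piecewise_mem_ball hzR s
      have hpj : p j = a j := by simp [hp, hj]
      have hmem : ∀ ζ ∈ Metric.closedBall (1 : ℂ) ρ₀, Function.update p j (a j * ζ) ∈ Ω :=
        fun ζ hζ => hball (update_mem_ball hpR (by
          rw [mem_closedBall_iff_norm, hρ₀, le_div_iff₀ (by positivity)] at hζ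
          rw [← mul_sub_one, norm_mul]
          linarith))
      have key := hbar (fun ζ => g (Function.update p j (a j * ζ))) (δ / 3) (by positivity)
        (husc.comp (g := fun ζ : ℂ => Function.update p j (a j * ζ)) (by fun_prop) hmem)
        (fun ζ hζ => hM _ (hmem ζ hζ))
        (fun q r hr0 hsub k hk hle => by
          have hu : ∀ ζ : ℂ, Function.update p j (a j * q) + ζ • Pi.single j (a j * r) =
              Function.update p j (a j * (q + ζ * r)) := fun ζ => by
            rw [update_add_smul_single]; ring_nf
          refine EReal.coe_le_coe_iff.1 (hpsh.le_angleMean (w := Pi.single j (a j * r))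
            (fun ζ hζ => ?_) hk.integrableOn_Ioc fun θ => ?_)
          · rw [hu]
            refine hmem _ (hsub ?_)
            rw [mem_closedBall_iff_norm, add_sub_cancel_left, norm_mul, Complex.norm_real,
              Real.norm_eq_abs, abs_of_pos hr0]
            exact mul_le_of_le_one_left hr0.le hζ
          · rw [hu]
            exact EReal.coe_le_coe_iff.2 (hle θ))
        (fun t ζ ht ht1 hζ _ => by
          have := (hr j t ht ht1 _ (hmem ζ hζ)).2
          simpa [mul_left_comm] using this)
        (z j / a j) hzj
      rw [mul_one, ← hpj, Function.update_eq_self, hpj, mul_div_cancel₀ _ haj] at key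
      linarith

theorem corollary3p3 {n : ℕ} (Ω : Set (Fin n → ℂ)) (hΩ : IsReinhardtDomain Ω)
    (hbdd : Bornology.IsBounded Ω) (φ : (Fin n → ℂ) → ℝ) (hφ : UniformContinuousOn φ Ω) :
    ∃ g : (Fin n → ℂ) → ℝ, ContinuousOn g Ω ∧
      ∀ z ∈ Ω, perronBremermann Ω φ z = ((g z : ℝ) : EReal) := by
  obtain ⟨M, hM⟩ := hφ.exists_abs_le hbdd
  obtain ⟨g, hg, husc, hgM, hpsh⟩ :=
    exists_isPSH_eq_perronBremermann hΩ.isOpen hφ.continuousOn hM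
  refine ⟨g, fun a ha => ?_, hg⟩
  refine tendsto_order.2 ⟨fun c hc => ?_, fun c hc => husc a ha c hc⟩
  have h := hpsh.eventually_sub_le hΩ.isOpen husc hgM
    (fun τ hτ => exists_rotation_modulus hΩ hbdd hφ hg husc hgM hpsh hτ) ha Finset.univ
    ((g a - c) / 2) (by linarith)
  refine (h.filter_mono nhdsWithin_le_nhds).mono fun z hz => ?_
  rw [Finset.piecewise_univ] at hz
  linarith
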